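/- Graphs are finite and may have loops and parallel edges. For a graph $G$ and an edge set $X$, let $G\langle X\rangle$ be the subgraph whose edges are those of $X$ and whose vertices are the ends of the edges of $X$; let $\Delta G=|E(G)|-|V(G)|$. A cacti-graph is a graph with no isolated vertices, no leaves (vertices of degree $1$, a loop counting twice) and no component that is a cycle. For $k\ge 1$ the $k$-circular matroid $M_k(G)$ is the matroid on $E(G)$ whose circuits are the sets $C\subseteq E(G)$ such that $G\langle C\rangle$ is a cacti-graph with $\Delta G\langle C\rangle=k$. A matroid is connected if it has no loops, no coloops, and every two of its elements lie in a common circuit; a non-separating cocircuit of a connected matroid $M$ is a cocircuit $K$ such that $M\setminus K$ is connected. Write $S(x,G)$ for the set of edges incident to the vertex $x$ and $\mathcal S(G)=\{S(x,G):x\in V(G)\}$. A vertex $x$ is $k$-big if $|S(x,G)|>\rho_k^*(G)+1$, where $\rho_k^*(G)$ is the rank of the dual of $M_k(G)$. Graphs $G,G'$ with $E(G)=E(G')$ are strongly isomorphic if there is a bijection $\nu:V(G)\to V(G')$ such that every edge has ends $x,y$ in $G$ if and only if it has ends $\nu(x),\nu(y)$ in $G'$. **Theorem.** Let $k\ge 1$,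 and let $G$ and $G'$ be finite graphs without isolated vertices. Suppose that $M_k(G)$ is connected and that $v$ is a vertex of $G$ such that 1. $S(x,G)$ is a non-separating cocircuit of $M_k(G)$ for every vertex $x\ne v$ of $G$; 2. every loop of $G$ is incident to $v$; 3. $v$ is not $k$-big; 4. $G\setminus v$ has no component that is a tree (a single vertex without edges being a tree). If $M_k(G')=M_k(G)$, then $\mathcal S(G)=\mathcal S(G')$, and $G$ and $G'$ are strongly isomorphic. -/

import Mathlib

namespace Graph

open Set

variable {α α' β : Type*}

/-! ### Finite multigraphs -/

/-- A finite graph (parallel edges and loops are allowed). -/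
def IsFinite (G : Graph α β) : Prop := V(G).Finite ∧ E(G).Finite

/-- `G` has no isolated vertex: every vertex is an end of some edge. -/
def NoIsolatedVertex (G : Graph α β) : Prop := ∀ x ∈ V(G), ∃ e, G.Inc e x

/-- The degree of a vertex; a loop counts twice. -/
noncomputable def eDegree (G : Graph α β) (x : α) : ℕ∞ :=
  (G.incidenceSet x).encard + (G.loopSet x).encard

/-- A leaf is a vertex of degree one. -/
def IsLeaf (G : Graph α β) (x : α) : Prop := x ∈ V(G) ∧ G.eDegree x = 1

/-- `G` is connected: it has a vertex, and any two vertices are joined by a walk. -/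
def IsConnected (G : Graph α β) : Prop :=
  V(G).Nonempty ∧ ∀ x ∈ V(G), ∀ y ∈ V(G), Relation.ReflTransGen G.Adj x y

/-- `H` is a (connected) component of `G`. -/
def IsComponent (H G : Graph α β) : Prop := H ≤c G ∧ H.IsConnected

/-- `G` is a cycle: a finite connected graph in which every vertex has degree two.  A loop with its
vertex, and a pair of parallel edges with their ends, are cycles. -/
def IsCycleGraph (G : Graph α β) : Prop :=
  V(G).Finite ∧ G.IsConnected ∧ ∀ x ∈ V(G), G.eDegree x = 2

/-- `G` is a tree: connected, without a subgraph that is a cycle.  A single vertex is a tree. -/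
def IsTreeGraph (G : Graph α β) : Prop := G.IsConnected ∧ ∀ H ≤ G, ¬ H.IsCycleGraph

/-- `G` is a cacti-graph: no isolated vertices, no leaves, and no cycle components. -/
def IsCacti (G : Graph α β) : Prop :=
  G.NoIsolatedVertex ∧ (∀ x, ¬ G.IsLeaf x) ∧
    ∀ H : Graph α β, H.IsComponent G → ¬ H.IsCycleGraph

/-- `Δ G = |E(G)| - |V(G)|`, for a finite graph `G`. -/
noncomputable def excess (G : Graph α β) : ℤ := (E(G).ncard : ℤ) - (V(G).ncard : ℤ)

/-- The set of all ends of edges in `X`. -/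
def ends (G : Graph α β) (X : Set β) : Set α := {x | ∃ e ∈ X, G.Inc e x}

/-- The subgraph `G⟨X⟩` of `G` induced by a set `X` of edges: its edges are those in `X`, its
vertices are the ends of these. -/
def edgeInduce (G : Graph α β) (X : Set β) : Graph α β := (G.restrict X).induce (G.ends X)

/-- The family `𝒞ₖ(G)` of all edge sets `C` such that `Δ G⟨C⟩ = k` and `G⟨C⟩` is a cacti-graph. -/
def circuitFamily (G : Graph α β) (k : ℕ) : Set (Set β) :=
  {C | C ⊆ E(G) ∧ (G.edgeInduce C).excess = k ∧ (G.edgeInduce C).IsCacti}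

/-- The star `S(x, G)` of a vertex `x`: the set of edges incident to `x`. -/
def vertexStar (G : Graph α β) (x : α) : Set β := {e | G.Inc e x}

/-- The set `𝒮(G)` of all vertex stars of `G`. -/
def vertexStars (G : Graph α β) : Set (Set β) := {S | ∃ x ∈ V(G), S = G.vertexStar x}

/-- Two graphs on the same edge set are strongly isomorphic if some bijection of their vertex sets
carries the ends of each edge in the one to the ends of the same edge in the other. -/
def StronglyIsomorphic (G : Graph α β) (G' : Graph α' β) : Prop :=
  E(G) = E(G') ∧ ∃ ν : V(G) ≃ V(G'), ∀ (e : β) (x y : V(G)),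
    G.IsLink e x y ↔ G'.IsLink e (ν x) (ν y)

/-! ### Auxiliary facts, used to show that `𝒞ₖ(G)` is the set of circuits of a matroid -/

lemma vertexSet_edgeInduce (G : Graph α β) (X : Set β) : V(G.edgeInduce X) = G.ends X := rfl

lemma edgeInduce_isLink (G : Graph α β) (X : Set β) (e : β) (x y : α) :
    (G.edgeInduce X).IsLink e x y ↔ e ∈ X ∧ G.IsLink e x y := by
  constructor
  · rintro ⟨h, -, -⟩
    exact h
  · rintro ⟨he, h⟩
    exact ⟨⟨he, h⟩, ⟨e, he, h.inc_left⟩, ⟨e, he, h.inc_right⟩⟩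

lemma edgeInduce_inc (G : Graph α β) (X : Set β) (e : β) (x : α) :
    (G.edgeInduce X).Inc e x ↔ e ∈ X ∧ G.Inc e x := by
  simp [Inc, edgeInduce_isLink]

lemma edgeSet_edgeInduce (G : Graph α β) {X : Set β} (hX : X ⊆ E(G)) :
    E(G.edgeInduce X) = X := by
  ext e
  rw [edge_mem_iff_exists_isLink]
  simp only [edgeInduce_isLink]
  constructor
  · rintro ⟨x, y, h, -⟩
    exact h
  · intro h
    obtain ⟨x, y, hxy⟩ := G.exists_isLink_of_mem_edgeSet (hX h)
    exact ⟨x, y, h, hxy⟩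

lemma ends_mono (G : Graph α β) {X Y : Set β} (h : X ⊆ Y) : G.ends X ⊆ G.ends Y := by
  rintro x ⟨e, he, hx⟩
  exact ⟨e, h he, hx⟩

lemma ends_union (G : Graph α β) (X Y : Set β) : G.ends (X ∪ Y) = G.ends X ∪ G.ends Y := by
  ext x
  simp only [ends, mem_union, mem_ofPred_eq]
  constructor
  · rintro ⟨e, he | he, hx⟩
    · exact Or.inl ⟨e, he, hx⟩
    · exact Or.inr ⟨e, he, hx⟩
  · rintro (⟨e, he, hx⟩ | ⟨e, he, hx⟩)
    · exact ⟨e, Or.inl he, hx⟩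
    · exact ⟨e, Or.inr he, hx⟩

lemma ends_inter_subset (G : Graph α β) (X Y : Set β) :
    G.ends (X ∩ Y) ⊆ G.ends X ∩ G.ends Y :=
  subset_inter (G.ends_mono inter_subset_left) (G.ends_mono inter_subset_right)

lemma finite_ends (G : Graph α β) {X : Set β} (hX : X.Finite) : (G.ends X).Finite := by
  have h : G.ends X = ⋃ e ∈ X, {x | G.Inc e x} := by
    ext x
    simp [ends]
  rw [h]
  refine hX.biUnion fun e _ => ?_
  by_cases he : ∃ x y, G.IsLink e x y
  · obtain ⟨x, y, hxy⟩ := he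
    refine (Set.toFinite {x, y}).subset fun z hz => ?_
    simpa using Inc.eq_or_eq_of_isLink hz hxy
  · refine Set.finite_empty.subset fun z hz => ?_
    obtain ⟨y, hy⟩ := hz
    exact he ⟨z, y, hy⟩

open Classical in
/-- The number of times that `x` is an end of `e`. -/
noncomputable def multEnd (G : Graph α β) (e : β) (x : α) : ℕ :=
  (if G.Inc e x then 1 else 0) + (if G.IsLoopAt e x then 1 else 0)

open Classical in
lemma sum_multEnd (G : Graph α β) {e : β} {x y : α} (h : G.IsLink e x y) (W : Finset α) :
    ∑ w ∈ W, G.multEnd e w = (if x ∈ W then 1 else 0) + (if y ∈ W then 1 else 0) := by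
  have key : ∀ w, G.multEnd e w = (if x = w then 1 else 0) + (if y = w then 1 else 0) := by
    intro w
    have h1 : G.Inc e w ↔ x = w ∨ y = w := by
      constructor
      · intro hw
        rcases hw.eq_or_eq_of_isLink h with rfl | rfl
        · exact Or.inl rfl
        · exact Or.inr rfl
      · rintro (rfl | rfl)
        · exact h.inc_left
        · exact h.inc_right
    have h2 : G.IsLoopAt e w ↔ x = w ∧ y = w := by
      constructor
      · intro hw
        exact ⟨(hw.eq_of_inc h.inc_left).symm, (hw.eq_of_inc h.inc_right).symm⟩
      · rintro ⟨rfl, rfl⟩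
        exact h
    simp only [multEnd, h1, h2]
    by_cases hx : x = w <;> by_cases hy : y = w <;> simp [hx, hy]
  simp only [key, Finset.sum_add_distrib, Finset.sum_ite_eq]

lemma eDegree_eq_sum (G : Graph α β) {D : Finset β} {x : α} (h : G.incidenceSet x ⊆ D) :
    G.eDegree x = ((∑ e ∈ D, G.multEnd e x : ℕ) : ℕ∞) := by
  classical
  have h1 : G.incidenceSet x = ((D.filter (fun e => G.Inc e x) : Finset β) : Set β) := by
    ext e
    simp only [Finset.coe_filter, mem_ofPred_eq, mem_incidenceSet]
    exact ⟨fun he => ⟨h he, he⟩, fun he => he.2⟩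
  have h2 : G.loopSet x = ((D.filter (fun e => G.IsLoopAt e x) : Finset β) : Set β) := by
    ext e
    simp only [Finset.coe_filter, mem_ofPred_eq, mem_loopSet]
    exact ⟨fun he => ⟨h he.inc, he⟩, fun he => he.2⟩
  rw [eDegree, h1, h2, Set.encard_coe_eq_coe_finsetCard, Set.encard_coe_eq_coe_finsetCard]
  simp only [multEnd, Finset.sum_add_distrib, Finset.card_filter]
  push_cast
  rfl

/-- A cycle has as many edges as vertices. -/
lemma IsCycleGraph.ncard_eq {H : Graph α β} (hH : H.IsCycleGraph) (hE : E(H).Finite) :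
    E(H).ncard = V(H).ncard := by
  classical
  obtain ⟨hV, -, hdeg⟩ := hH
  have h1 : ∀ x ∈ hV.toFinset, ∑ e ∈ hE.toFinset, H.multEnd e x = 2 := by
    intro x hx
    have h2 := hdeg x (by simpa using hx)
    rw [H.eDegree_eq_sum (D := hE.toFinset)
      (by simpa using H.incidenceSet_subset_edgeSet x)] at h2
    exact_mod_cast h2
  have h2 : ∀ e ∈ hE.toFinset, ∑ x ∈ hV.toFinset, H.multEnd e x = 2 := by
    intro e he
    obtain ⟨x, y, hxy⟩ := H.exists_isLink_of_mem_edgeSet (by simpa using he : e ∈ E(H))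
    rw [H.sum_multEnd hxy]
    simp [hxy.left_mem, hxy.right_mem]
  have h3 := Finset.sum_comm (s := hV.toFinset) (t := hE.toFinset) (f := fun x e => H.multEnd e x)
  rw [Finset.sum_congr rfl h1, Finset.sum_congr rfl h2] at h3
  simp only [Finset.sum_const, smul_eq_mul] at h3
  rw [Set.ncard_eq_toFinset_card _ hE, Set.ncard_eq_toFinset_card _ hV]
  omega

lemma excess_edgeInduce (G : Graph α β) {X : Set β} (hX : X ⊆ E(G)) :
    (G.edgeInduce X).excess = (X.ncard : ℤ) - ((G.ends X).ncard : ℤ) := by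
  rw [excess, edgeSet_edgeInduce G hX, vertexSet_edgeInduce]

/-- A minimal edge set of excess at least `k` belongs to `𝒞ₖ(G)`. -/
lemma mem_circuitFamily_of_minimal (G : Graph α β) {k : ℕ} (hk : 1 ≤ k) {C : Set β}
    (hCE : C ⊆ E(G)) (hfin : C.Finite) (hC : (G.ends C).ncard + k ≤ C.ncard)
    (hmin : ∀ Y ⊆ C, Y ≠ C → Y.ncard < (G.ends Y).ncard + k) : C ∈ G.circuitFamily k := by
  have hendfin := G.finite_ends hfin
  refine ⟨hCE, ?_, ?_, ?_, ?_⟩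
  · rw [excess_edgeInduce G hCE]
    have hne : C.Nonempty := by
      rw [← Set.ncard_pos hfin]
      omega
    obtain ⟨e, he⟩ := hne
    have h1 := hmin (C \ {e}) sdiff_subset
      (fun h => ((h.symm ▸ he : e ∈ C \ {e})).2 rfl)
    have h2 := Set.ncard_sdiff_singleton_add_one he hfin
    have h3 := Set.ncard_le_ncard (G.ends_mono (sdiff_subset : C \ {e} ⊆ C)) hendfin
    omega
  · rintro x ⟨e, he, hx⟩
    exact ⟨e, (edgeInduce_inc ..).2 ⟨he, hx⟩⟩
  · rintro x ⟨hxV, hdeg⟩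
    obtain ⟨e, he, hx⟩ := hxV
    have hinc : (G.edgeInduce C).incidenceSet x ⊆ {e} := by
      have hle : ((G.edgeInduce C).incidenceSet x).encard ≤ 1 := by
        rw [← hdeg, eDegree]
        exact le_self_add
      rw [Set.encard_le_one_iff] at hle
      intro f hf
      exact hle f e hf ((edgeInduce_inc ..).2 ⟨he, hx⟩)
    have h1 := hmin (C \ {e}) sdiff_subset
      (fun h => ((h.symm ▸ he : e ∈ C \ {e})).2 rfl)
    have h2 := Set.ncard_sdiff_singleton_add_one he hfin
    have h3 : G.ends (C \ {e}) ⊆ G.ends C \ {x} := by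
      rintro y ⟨f, hf, hy⟩
      refine ⟨⟨f, hf.1, hy⟩, ?_⟩
      rintro rfl
      exact hf.2 (hinc ((edgeInduce_inc ..).2 ⟨hf.1, hy⟩))
    have h4 := Set.ncard_le_ncard h3 (hendfin.subset sdiff_subset)
    have hxC : x ∈ G.ends C := ⟨e, he, hx⟩
    have h5 := Set.ncard_sdiff_singleton_add_one hxC hendfin
    omega
  · rintro H ⟨hcl, hconn⟩ hcyc
    have hHC : E(H) ⊆ C := by
      have := hcl.le.edgeSet_mono
      rwa [edgeSet_edgeInduce G hCE] at this
    have hVC : V(H) ⊆ G.ends C := hcl.le.vertexSet_mono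
    have hHfin := hfin.subset hHC
    have hVfin := hendfin.subset hVC
    have heq := hcyc.ncard_eq hHfin
    have hpos : 0 < V(H).ncard := (Set.ncard_pos hVfin).2 hconn.1
    have hne : (C \ E(H)) ≠ C := by
      intro h
      have hEne : E(H).Nonempty := by
        rw [← Set.ncard_pos hHfin]
        omega
      obtain ⟨e, he⟩ := hEne
      exact ((h.symm ▸ hHC he : e ∈ C \ E(H))).2 he
    have h1 := hmin (C \ E(H)) sdiff_subset hne
    have h2 := Set.ncard_sdiff_add_ncard_of_subset hHC hfin
    have h3 : G.ends (C \ E(H)) ⊆ G.ends C \ V(H) := by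
      rintro y ⟨f, hf, hy⟩
      refine ⟨⟨f, hf.1, hy⟩, fun hyH => hf.2 ?_⟩
      exact hcl.closed ((edgeInduce_inc ..).2 ⟨hf.1, hy⟩) hyH
    have h4 := Set.ncard_le_ncard h3 (hendfin.subset sdiff_subset)
    have h5 := Set.ncard_sdiff_add_ncard_of_subset hVC hendfin
    omega

/-- An edge set contains no member of `𝒞ₖ(G)` if and only if all its subsets have excess
less than `k`. -/
lemma forall_circuitFamily_not_subset_iff (G : Graph α β) {k : ℕ} (hk : 1 ≤ k) {I : Set β}
    (hIE : I ⊆ E(G)) (hfin : I.Finite) :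
    (∀ C ∈ G.circuitFamily k, ¬ C ⊆ I) ↔ ∀ Y ⊆ I, Y.ncard < (G.ends Y).ncard + k := by
  constructor
  · intro h
    by_contra! hcon
    let P : Set β → Prop := fun Y => Y ⊆ I ∧ (G.ends Y).ncard + k ≤ Y.ncard
    have hPfin : {Y | P Y}.Finite := hfin.finite_subsets.subset fun Y hY => hY.1
    obtain ⟨C, hC⟩ := hPfin.exists_minimal hcon
    refine h C (G.mem_circuitFamily_of_minimal hk (hC.1.1.trans hIE) (hfin.subset hC.1.1)
      hC.1.2 ?_) hC.1.1
    intro Y hYC hne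
    by_contra! hcon'
    exact hne (hYC.antisymm (hC.2 (⟨hYC.trans hC.1.1, hcon'⟩ : P Y) hYC))
  · rintro h C ⟨hCE, hex, -⟩ hCI
    rw [excess_edgeInduce G hCE] at hex
    have := h C hCI
    omega

lemma circuitFamily_aug (G : Graph α β) {k : ℕ} (hE : E(G).Finite) {I J : Set β}
    (hIE : I ⊆ E(G)) (hJE : J ⊆ E(G))
    (hI : ∀ Y ⊆ I, Y.ncard < (G.ends Y).ncard + k) (hJ : ∀ Y ⊆ J, Y.ncard < (G.ends Y).ncard + k)
    (hIJ : I.ncard < J.ncard) :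
    ∃ e ∈ J, e ∉ I ∧ ∀ Y ⊆ insert e I, Y.ncard < (G.ends Y).ncard + k := by
  by_contra! hcon
  have hIf := hE.subset hIE
  have hJf := hE.subset hJE
  -- the tight subsets of `I`, those of excess `k - 1`, are closed under unions
  have htight : ∀ Y ⊆ I, ∀ Z ⊆ I, (G.ends Y).ncard + k = Y.ncard + 1 →
      (G.ends Z).ncard + k = Z.ncard + 1 → (G.ends (Y ∪ Z)).ncard + k = (Y ∪ Z).ncard + 1 := by
    intro Y hY Z hZ h1 h2
    have hYf := hIf.subset hY
    have hZf := hIf.subset hZ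
    have h3 := hI (Y ∪ Z) (union_subset hY hZ)
    have h4 := hI (Y ∩ Z) (inter_subset_left.trans hY)
    have h5 := Set.ncard_union_add_ncard_inter Y Z hYf hZf
    have h6 := Set.ncard_union_add_ncard_inter (G.ends Y) (G.ends Z) (G.finite_ends hYf)
      (G.finite_ends hZf)
    have h7 := Set.ncard_le_ncard (G.ends_inter_subset Y Z)
      ((G.finite_ends hYf).subset inter_subset_left)
    rw [← ends_union] at h6
    omega
  -- every element of `J` outside `I` has its ends in a tight subset of `I`
  have hex : ∀ e ∈ J, e ∉ I → ∃ T ⊆ I, (G.ends T).ncard + k = T.ncard + 1 ∧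
      G.ends {e} ⊆ G.ends T := by
    intro e heJ heI
    obtain ⟨Y, hYI, hY⟩ := hcon e heJ heI
    have hYf : Y.Finite := (hIf.insert e).subset hYI
    have heY : e ∈ Y := by
      by_contra h
      have := hI Y ((subset_insert_iff_of_notMem h).1 hYI)
      omega
    have hTI : Y \ {e} ⊆ I := by
      rintro f ⟨hf, hfe⟩
      exact (hYI hf).resolve_left hfe
    have h1 := hI _ hTI
    have h2 := Set.ncard_sdiff_singleton_add_one heY hYf
    have hsub : G.ends (Y \ {e}) ⊆ G.ends Y := G.ends_mono sdiff_subset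
    have h3 := Set.ncard_le_ncard hsub (G.finite_ends hYf)
    refine ⟨Y \ {e}, hTI, by omega, ?_⟩
    rw [Set.eq_of_subset_of_ncard_le hsub (by omega) (G.finite_ends hYf)]
    exact G.ends_mono (by simpa using heY)
  -- hence a single tight subset of `I` does
  have hall : ∀ D : Set β, D.Finite → D.Nonempty → D ⊆ J \ I →
      ∃ T ⊆ I, (G.ends T).ncard + k = T.ncard + 1 ∧ G.ends D ⊆ G.ends T := by
    intro D hD
    induction D, hD using Set.Finite.induction_on with
    | empty => exact fun h => absurd h (by simp)
    | @insert a s has hs ih =>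
      intro _ hsub
      obtain ⟨T, hT, hTt, hTe⟩ := hex a (hsub (mem_insert a s)).1 (hsub (mem_insert a s)).2
      rcases s.eq_empty_or_nonempty with rfl | hne
      · exact ⟨T, hT, hTt, by simpa using hTe⟩
      obtain ⟨T', hT', hTt', hTe'⟩ := ih hne ((subset_insert a s).trans hsub)
      refine ⟨T ∪ T', union_subset hT hT', htight T hT T' hT' hTt hTt', ?_⟩
      rw [insert_eq, ends_union, ends_union]
      exact union_subset_union hTe hTe'
  have hdiff := Set.ncard_inter_add_ncard_sdiff_eq_ncard J I hJf
  have hdiff' := Set.ncard_inter_add_ncard_sdiff_eq_ncard I J hIf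
  rw [inter_comm] at hdiff'
  have hpos : 0 < (J \ I).ncard := by omega
  obtain ⟨T, hT, hTt, hTe⟩ := hall (J \ I) (hJf.subset sdiff_subset)
    ((Set.ncard_pos (hJf.subset sdiff_subset)).1 hpos) subset_rfl
  have hTf := hIf.subset hT
  have h1 := hJ ((J \ I) ∪ (J ∩ T)) (union_subset sdiff_subset inter_subset_left)
  have h2 : ((J \ I) ∪ (J ∩ T)).ncard = (J \ I).ncard + (J ∩ T).ncard := by
    refine Set.ncard_union_eq ?_ (hJf.subset sdiff_subset) (hJf.subset inter_subset_left)
    rw [Set.disjoint_left]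
    exact fun x hx hx' => hx.2 (hT hx'.2)
  have h3 : (G.ends ((J \ I) ∪ (J ∩ T))).ncard ≤ (G.ends T).ncard := by
    refine Set.ncard_le_ncard ?_ (G.finite_ends hTf)
    rw [ends_union]
    exact union_subset hTe (G.ends_mono inter_subset_right)
  have h4 := Set.ncard_inter_add_ncard_sdiff_eq_ncard T J hTf
  rw [inter_comm] at h4
  have h5 : (T \ J).ncard ≤ (I \ J).ncard :=
    Set.ncard_le_ncard (sdiff_subset_sdiff_left hT) (hIf.subset sdiff_subset)
  omega

/-! ### The `k`-circular matroid -/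

/-- The `k`-circular matroid `Mₖ(G)` of a finite graph `G`, for `k ≥ 1`: the matroid on the edge
set of `G` in which a set is independent if it contains no member of `𝒞ₖ(G)`. -/
def kCircularMatroid (G : Graph α β) (hG : G.IsFinite) (k : ℕ) (hk : 1 ≤ k) : Matroid β :=
  (IndepMatroid.ofFinite hG.2 (fun I => I ⊆ E(G) ∧ ∀ C ∈ G.circuitFamily k, ¬ C ⊆ I)
    ⟨empty_subset _, by
      rw [forall_circuitFamily_not_subset_iff G hk (empty_subset _) finite_empty]
      intro Y hY
      rw [subset_empty_iff.1 hY, ncard_empty]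
      omega⟩
    (fun _ _ hJ hIJ => ⟨hIJ.trans hJ.1, fun C hC hCI => hJ.2 C hC (hCI.trans hIJ)⟩)
    (by
      rintro I J ⟨hIE, hI⟩ ⟨hJE, hJ⟩ hlt
      rw [forall_circuitFamily_not_subset_iff G hk hIE (hG.2.subset hIE)] at hI
      rw [forall_circuitFamily_not_subset_iff G hk hJE (hG.2.subset hJE)] at hJ
      obtain ⟨e, heJ, heI, h⟩ := G.circuitFamily_aug hG.2 hIE hJE hI hJ hlt
      have hE : insert e I ⊆ E(G) := insert_subset (hJE heJ) hIE
      exact ⟨e, heJ, heI, hE,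
        (forall_circuitFamily_not_subset_iff G hk hE (hG.2.subset hE)).2 h⟩)
    (fun _ hI => hI.1)).matroid

/-- A member of `𝒞ₖ(G)` properly contains no
edge set of excess at least `k`. -/
lemma ncard_lt_of_subset_circuitFamily (G : Graph α β) {k : ℕ} {C Y : Set β} (hfin : C.Finite)
    (hC : C ∈ G.circuitFamily k) (hYC : Y ⊆ C) (hne : Y ≠ C) :
    Y.ncard < (G.ends Y).ncard + k := by
  classical
  by_contra! hcon
  obtain ⟨hCE, hex, hiso, hleaf, hcomp⟩ := hC
  rw [excess_edgeInduce G hCE] at hex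
  set H := G.edgeInduce C with hH
  have hendfin := G.finite_ends hfin
  have hDf : (C \ Y).Finite := hfin.subset sdiff_subset
  have hWf : (G.ends C \ G.ends Y).Finite := hendfin.subset sdiff_subset
  set D := hDf.toFinset with hD
  set W := hWf.toFinset with hW
  have hcardD : D.card + Y.ncard = C.ncard := by
    rw [hD, ← Set.ncard_eq_toFinset_card _ hDf]
    exact Set.ncard_sdiff_add_ncard_of_subset hYC hfin
  have hcardW : W.card + (G.ends Y).ncard = (G.ends C).ncard := by
    rw [hW, ← Set.ncard_eq_toFinset_card _ hWf]
    exact Set.ncard_sdiff_add_ncard_of_subset (G.ends_mono hYC) hendfin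
  have hcard : D.card ≤ W.card := by omega
  have hWmem : ∀ w, w ∈ W ↔ w ∈ G.ends C ∧ w ∉ G.ends Y := fun w => by
    simp [hW]
  have hDmem : ∀ e, e ∈ D ↔ e ∈ C ∧ e ∉ Y := fun e => by simp [hD]
  have hincD : ∀ w ∈ W, H.incidenceSet w ⊆ D := by
    intro w hw e he
    obtain ⟨heC, hew⟩ := (edgeInduce_inc ..).1 he
    exact (hDmem e).2 ⟨heC, fun heY => ((hWmem w).1 hw).2 ⟨e, heY, hew⟩⟩
  have hdeg2 : ∀ w ∈ W, 2 ≤ ∑ e ∈ D, H.multEnd e w := by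
    intro w hw
    have hwV : w ∈ V(H) := ((hWmem w).1 hw).1
    obtain ⟨e, he⟩ := hiso w hwV
    have h0 : 1 ≤ ∑ e ∈ D, H.multEnd e w := by
      refine le_trans ?_ (Finset.single_le_sum (f := fun e => H.multEnd e w)
        (fun _ _ => Nat.zero_le _) (hincD w hw he))
      simp [multEnd, he]
    have h1 : ∑ e ∈ D, H.multEnd e w ≠ 1 := by
      intro h1
      refine hleaf w ⟨hwV, ?_⟩
      rw [H.eDegree_eq_sum (hincD w hw), h1]
      rfl
    omega
  have hle2 : ∀ e ∈ D, ∑ w ∈ W, H.multEnd e w ≤ 2 := by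
    intro e he
    obtain ⟨x, y, hxy⟩ := G.exists_isLink_of_mem_edgeSet (hCE ((hDmem e).1 he).1)
    rw [H.sum_multEnd ((edgeInduce_isLink ..).2 ⟨((hDmem e).1 he).1, hxy⟩)]
    split_ifs <;> omega
  have hsum := Finset.sum_comm (s := W) (t := D) (f := fun x e => H.multEnd e x)
  have hlow : W.card * 2 ≤ ∑ w ∈ W, ∑ e ∈ D, H.multEnd e w := by
    simpa using Finset.card_nsmul_le_sum W _ 2 hdeg2
  have hup : ∑ e ∈ D, ∑ w ∈ W, H.multEnd e w ≤ D.card * 2 := by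
    simpa using Finset.sum_le_card_nsmul D _ 2 hle2
  have hdeg : ∀ w ∈ W, H.eDegree w = 2 := by
    intro w hw
    rw [H.eDegree_eq_sum (hincD w hw)]
    have h1 : ∑ w ∈ W, 2 = ∑ w ∈ W, ∑ e ∈ D, H.multEnd e w := by
      simp only [Finset.sum_const, smul_eq_mul]
      omega
    rw [← (Finset.sum_eq_sum_iff_of_le hdeg2).1 h1 w hw]
    rfl
  have hends : ∀ e ∈ D, ∀ x y, H.IsLink e x y → x ∈ W ∧ y ∈ W := by
    intro e he x y hxy
    have h1 : ∑ e ∈ D, ∑ w ∈ W, H.multEnd e w = ∑ e ∈ D, 2 := by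
      simp only [Finset.sum_const, smul_eq_mul]
      omega
    have h2 := (Finset.sum_eq_sum_iff_of_le hle2).1 h1 e he
    rw [H.sum_multEnd hxy] at h2
    by_contra hcon'
    split_ifs at h2 <;> first | omega | tauto
  obtain ⟨e, heC, heY⟩ : ∃ e ∈ C, e ∉ Y := by
    by_contra! h
    exact hne (hYC.antisymm h)
  obtain ⟨w, w', hw⟩ := G.exists_isLink_of_mem_edgeSet (hCE heC)
  have hwW : w ∈ W :=
    (hends e ((hDmem e).2 ⟨heC, heY⟩) w w' ((edgeInduce_isLink ..).2 ⟨heC, hw⟩)).1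
  have hstep : ∀ x ∈ W, ∀ y, H.Adj x y → y ∈ W := by
    rintro x hx y ⟨f, hf⟩
    exact (hends f (hincD x hx hf.inc_left) x y hf).2
  let R : Set α := {x | Relation.ReflTransGen H.Adj w x}
  have hRW : ∀ x ∈ R, x ∈ W := by
    intro x hx
    induction (hx : Relation.ReflTransGen H.Adj w x) with
    | refl => exact hwW
    | tail _ hadj ih => exact hstep _ ih _ hadj
  have hRV : R ⊆ V(H) := fun x hx => ((hWmem x).1 (hRW x hx)).1
  have hlink : ∀ f x y, x ∈ R → ((H.induce R).IsLink f x y ↔ H.IsLink f x y) := by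
    intro f x y hx
    simp only [induce_isLink]
    exact ⟨fun h => h.1, fun h => ⟨h, hx, Relation.ReflTransGen.tail hx ⟨f, h⟩⟩⟩
  have hcl : (H.induce R) ≤c H := by
    refine IsClosedSubgraph.mk' (induce_le hRV) ?_
    rintro f x ⟨y, hxy⟩ hx
    exact ((hlink f x y hx).2 hxy).edge_mem
  have hreach : ∀ x ∈ R, Relation.ReflTransGen (H.induce R).Adj w x := by
    intro x hx
    induction (hx : Relation.ReflTransGen H.Adj w x) with
    | refl => exact .refl
    | @tail b c hb hadj ih =>
      obtain ⟨f, hf⟩ := hadj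
      exact ih.tail ⟨f, (hlink f b c hb).2 hf⟩
  have hsymm : ∀ x, Relation.ReflTransGen (H.induce R).Adj w x →
      Relation.ReflTransGen (H.induce R).Adj x w := by
    intro x hx
    induction hx with
    | refl => exact .refl
    | tail _ hadj ih => exact Relation.ReflTransGen.head hadj.symm ih
  have hconn : (H.induce R).IsConnected :=
    ⟨⟨w, Relation.ReflTransGen.refl⟩, fun x hx y hy =>
      (hsymm x (hreach x hx)).trans (hreach y hy)⟩
  refine hcomp (H.induce R) ⟨hcl, hconn⟩ ⟨W.finite_toSet.subset hRW, hconn, ?_⟩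
  intro x hx
  have hx' : x ∈ R := hx
  rw [← hdeg x (hRW x hx'), eDegree, eDegree]
  congr 2
  · ext f
    simp only [mem_incidenceSet, Inc, hlink f x _ hx']
  · ext f
    simp only [mem_loopSet, IsLoopAt, hlink f x _ hx']

/-- The circuits of `Mₖ(G)` are exactly the members of `𝒞ₖ(G)`. -/
theorem kCircularMatroid_isCircuit_iff (G : Graph α β) (hG : G.IsFinite) (k : ℕ) (hk : 1 ≤ k)
    (C : Set β) : (G.kCircularMatroid hG k hk).IsCircuit C ↔ C ∈ G.circuitFamily k := by
  have hindep : ∀ I, (G.kCircularMatroid hG k hk).Indep I ↔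
      I ⊆ E(G) ∧ ∀ C ∈ G.circuitFamily k, ¬ C ⊆ I := fun _ => Iff.rfl
  have hground : (G.kCircularMatroid hG k hk).E = E(G) := rfl
  rw [Matroid.isCircuit_iff_forall_ssubset, Matroid.Dep, hindep, hground]
  constructor
  · rintro ⟨⟨h1, hCE⟩, h2⟩
    push Not at h1
    obtain ⟨C', hC', hsub⟩ := h1 hCE
    rcases hsub.eq_or_ssubset with rfl | hss
    · exact hC'
    · exact absurd subset_rfl (((hindep C').1 (h2 hss)).2 C' hC')
  · intro hC
    have hfin := hG.2.subset hC.1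
    refine ⟨⟨fun h => h.2 C hC subset_rfl, hC.1⟩, fun I hI => ?_⟩
    rw [hindep, forall_circuitFamily_not_subset_iff G hk (hI.subset.trans hC.1)
      (hfin.subset hI.subset)]
    refine ⟨hI.subset.trans hC.1, fun Y hY => ?_⟩
    exact G.ncard_lt_of_subset_circuitFamily hfin hC (hY.trans hI.subset)
      (fun h => hI.2 (h ▸ hY))

end Graph

namespace Matroid

variable {β : Type*}

/-- A matroid is connected if it has no loops, no coloops, and every two of its elements belong
to a common circuit. -/
def IsConnectedMatroid (M : Matroid β) : Prop :=
  (∀ e, ¬ M.IsLoop e) ∧ (∀ e, ¬ M.IsColoop e) ∧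
    ∀ e ∈ M.E, ∀ f ∈ M.E, e ≠ f → ∃ C, M.IsCircuit C ∧ e ∈ C ∧ f ∈ C

/-- A non-separating cocircuit of a connected matroid `M` is a cocircuit whose deletion leaves a
connected matroid. -/
def IsNonseparatingCocircuit (M : Matroid β) (K : Set β) : Prop :=
  M.IsCocircuit K ∧ (M.delete K).IsConnectedMatroid

end Matroid

/-- A vertex `x` is `k`-big if its star has more than `ρ* + 1` edges, where `ρ*` is the corank of
`Mₖ(G)`, that is, the rank of the dual matroid. -/
def Graph.IsBigVertex {α β : Type*} (G : Graph α β) (hG : G.IsFinite) (k : ℕ) (hk : 1 ≤ k)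
    (x : α) : Prop :=
  (G.kCircularMatroid hG k hk).dual.eRank + 1 < (G.vertexStar x).encard

/-!
In a nonempty set of edges `X` without coloops every edge of a basis lies in a tight set, that is,
a set `T` with `|T| = |V(G⟨T⟩)| + k - 1`; tight sets are closed under unions because
`|T| - |V(G⟨T⟩)|` is supermodular, so a basis of `X` has `|V(G⟨X⟩)| + k - 1` elements. Deleting a
cocircuit `K` drops the rank by one; if `Mₖ(G) ∖ K` has no coloops, the edges outside `K`
therefore cover all vertices but one, whose star is `K`. Reading this in `G'`, the stars of the
vertices `x ≠ v` of `G` are stars of `G'`. Let `v'` be the one vertex of `G'` left over. An edge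
of `G` that avoids `v` has two ends whose stars it lies in, which are both its ends in `G'`, so
the star of `v'` is contained in the star of `v`. Both have a nonspanning complement, hence they
are equal as soon as the star of `v` is a cocircuit. For this, add an edge at `v` to the
complement of the star. If the result is independent, it is a base because `v` is not big.
Otherwise it contains a tight set, and since no component of `G ∖ v` is a tree, every set of
vertices touches at least as many of its edges as it has elements, which brings its rank up to
that of `Mₖ(G)`.
-/

namespace KCircular

open Set Graph

section Preliminaries

lemma exists_equiv_eqOn {α α' : Type*} {s : Set α} {t : Set α'} (hs : s.Finite)
    (ht : t.Finite) (hcard : s.ncard = t.ncard) {r : Set α} {f : α → α'} (hf : MapsTo f r t)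
    (hinj : InjOn f r) : ∃ ν : s ≃ t, ∀ x : s, x.1 ∈ r → (ν x : α') = f x := by
  have := hs.fintype
  have := ht.fintype
  have hcard' : Fintype.card s = t.toFinset.card := by
    rw [← ncard_eq_toFinset_card', ← hcard, ncard_eq_toFinset_card', toFinset_card]
  obtain ⟨ν, hν⟩ := MapsTo.exists_equiv_extend_of_card_eq hcard'
    (s := {x : s | x.1 ∈ r}) (f := fun x => f x) (fun x hx => mem_toFinset.2 (hf hx))
    fun x hx y hy hxy => Subtype.ext (hinj hx hy hxy)
  exact ⟨ν.trans (Equiv.subtypeEquivRight fun _ => mem_toFinset), hν⟩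

variable {β : Type*} {M : Matroid β} {I J B K : Set β}

lemma isBase_of_ncard_le [M.RankFinite] (hI : M.Indep I) (hB : M.IsBase B)
    (h : B.ncard ≤ I.ncard) : M.IsBase I := by
  obtain ⟨B₁, hB₁, hIB₁⟩ := hI.exists_isBase_superset
  rw [hB.ncard_eq_ncard_of_isBase hB₁] at h
  rwa [eq_of_subset_of_ncard_le hIB₁ h hB₁.finite]

lemma exists_isBase_notMem {e : β} (he : ¬ M.IsColoop e) : ∃ B, M.IsBase B ∧ e ∉ B := by
  simpa only [Matroid.isColoop_iff_forall_mem_isBase, not_forall, exists_prop] using he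

/-- Extending `J` by a base that meets `K` in one element only adds that element. -/
lemma encard_add_one_eq_of_isBase_delete (hK : M.IsCocircuit K) (hJ : (M.delete K).IsBase J)
    (hB : M.IsBase B) : J.encard + 1 = B.encard := by
  obtain ⟨e, heK⟩ := hK.nonempty
  obtain ⟨B₀, hB₀, hB₀K⟩ :=
    (Matroid.coindep_def.2 (hK.isCircuit.sdiff_singleton_indep heK)).exists_isBase_subset_compl
  obtain ⟨B₁, hB₁, hJB₁, hB₁JB₀⟩ := hJ.indep.of_delete.exists_isBase_subset_union_isBase hB₀
  have hJK : Disjoint J K := (subset_sdiff.1 hJ.subset_ground).2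
  have hB₁_sdiff : B₁ \ K = J :=
    (hJ.eq_of_subset_indep (Matroid.delete_indep_iff.2
      ⟨hB₁.indep.subset sdiff_subset, disjoint_sdiff_left⟩) (subset_sdiff.2 ⟨hJB₁, hJK⟩)).symm
  have hB₁_inter : B₁ ∩ K = {e} := by
    have hmeet : (K ∩ B₁).Nonempty := (Matroid.isCocircuit_iff_minimal.1 hK).prop B₁ hB₁
    rw [inter_comm] at hmeet
    refine hmeet.subset_singleton_iff.1 fun f hf => by_contra fun hfe => ?_
    rcases hB₁JB₀ hf.1 with hfJ | hfB₀
    · exact hJK.notMem_of_mem_left hfJ hf.2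
    · exact (hB₀K hfB₀).2 ⟨hf.2, hfe⟩
  rw [hB.encard_eq_encard_of_isBase hB₁, ← encard_sdiff_add_encard_inter B₁ K, hB₁_sdiff,
    hB₁_inter, encard_singleton]

end Preliminaries

section Graph

variable {α α' β : Type*} {G : Graph α β} {G' : Graph α' β} {X : Set β}

lemma isFinite_of_le {H : Graph α β} (hG : G.IsFinite) (hle : H ≤ G) : H.IsFinite :=
  ⟨hG.1.subset hle.vertexSet_mono, hG.2.subset hle.edgeSet_mono⟩

lemma ends_subset_vertexSet (G : Graph α β) (X : Set β) : G.ends X ⊆ V(G) :=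
  fun _ ⟨_, _, hx⟩ => hx.vertex_mem

lemma ends_edgeSet (hiso : G.NoIsolatedVertex) : G.ends E(G) = V(G) :=
  (ends_subset_vertexSet G _).antisymm fun x hx =>
    (hiso x hx).imp fun _ he => ⟨he.edge_mem, he⟩

lemma ends_sdiff_vertexStar_subset (G : Graph α β) (X : Set β) (x : α) :
    G.ends (X \ G.vertexStar x) ⊆ V(G) \ {x} := by
  rintro y ⟨e, ⟨-, hex⟩, hey⟩
  exact ⟨hey.vertex_mem, fun hyx : y = x => hex (hyx ▸ hey)⟩

lemma vertexStar_subset_of_notMem_ends {x : α} (hx : x ∉ G.ends (E(G) \ X)) :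
    G.vertexStar x ⊆ X :=
  fun e he => by_contra fun heX => hx ⟨e, ⟨Inc.edge_mem he, heX⟩, he⟩

/-- An edge that avoids `v` has two ends other than `v`, whose images exhaust its ends in `G'`. -/
lemma vertexStar_subset_of_forall_ne (hE : E(G') ⊆ E(G)) {v : V(G)}
    (hloop : ∀ e x, G.IsLoopAt e x → x = v) (ν : V(G) ≃ V(G'))
    (hν : ∀ x : V(G), x ≠ v → G.vertexStar x ⊆ G'.vertexStar (ν x)) :
    G'.vertexStar (ν v) ⊆ G.vertexStar v := by
  intro e he
  by_contra hev
  obtain ⟨x, y, hxy⟩ := G.exists_isLink_of_mem_edgeSet (hE (Inc.edge_mem he))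
  lift x to V(G) using hxy.left_mem
  lift y to V(G) using hxy.right_mem
  have hxv : x ≠ v := fun h => hev (h ▸ hxy.inc_left)
  have hyv : y ≠ v := fun h => hev (h ▸ hxy.inc_right)
  have hyx : y ≠ x := fun h => hxv (Subtype.ext (hloop e x (h ▸ hxy)))
  have hνne : ∀ {a b}, a ≠ b → (ν a : α') ≠ ν b := fun hab h =>
    hab (ν.injective (Subtype.ext h))
  obtain ⟨z, hz⟩ := hν x hxv hxy.inc_left
  have hyz : (ν y : α') = z :=
    (Inc.eq_or_eq_of_isLink (hν y hyv hxy.inc_right) hz).resolve_left (hνne hyx)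
  rcases Inc.eq_or_eq_of_isLink he hz with h | h
  · exact hνne hxv h.symm
  · exact hνne hyv (hyz.trans h.symm)

lemma vertexStars_eq_of_equiv (ν : V(G) ≃ V(G'))
    (hν : ∀ x : V(G), G.vertexStar x = G'.vertexStar (ν x)) : G.vertexStars = G'.vertexStars := by
  ext S
  constructor
  · rintro ⟨x, hx, rfl⟩
    exact ⟨ν ⟨x, hx⟩, (ν ⟨x, hx⟩).2, hν ⟨x, hx⟩⟩
  · rintro ⟨y, hy, rfl⟩
    refine ⟨ν.symm ⟨y, hy⟩, (ν.symm ⟨y, hy⟩).2, ?_⟩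
    rw [hν, ν.apply_symm_apply]

lemma stronglyIsomorphic_of_equiv (ν : V(G) ≃ V(G'))
    (hν : ∀ x : V(G), G.vertexStar x = G'.vertexStar (ν x)) : G.StronglyIsomorphic G' := by
  have hinc : ∀ e (x : V(G)), G.Inc e x ↔ G'.Inc e (ν x) := fun e x => Set.ext_iff.1 (hν x) e
  refine ⟨Set.ext fun e => ⟨fun he => ?_, fun he => ?_⟩, ν, fun e x y => ?_⟩
  · obtain ⟨x, y, hxy⟩ := G.exists_isLink_of_mem_edgeSet he
    exact ((hinc e ⟨x, hxy.left_mem⟩).1 hxy.inc_left).edge_mem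
  · obtain ⟨x, y, hxy⟩ := G'.exists_isLink_of_mem_edgeSet he
    refine ((hinc e (ν.symm ⟨x, hxy.left_mem⟩)).2 ?_).edge_mem
    rw [ν.apply_symm_apply]
    exact hxy.inc_left
  · have hends : (∀ z, G.Inc e z → z = x ∨ z = y) ↔ ∀ z, G'.Inc e z → z = ν x ∨ z = ν y := by
      constructor
      · intro h z hz
        obtain ⟨w, hw⟩ := ν.surjective ⟨z, hz.vertex_mem⟩
        obtain rfl : z = ν w := by rw [hw]
        simpa only [Subtype.coe_inj, ν.injective.eq_iff] using h w ((hinc e w).2 hz)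
      · intro h z hz
        simpa only [Subtype.coe_inj, ν.injective.eq_iff, Subtype.ext_iff] using
          h _ ((hinc e ⟨z, hz.vertex_mem⟩).1 hz)
    rw [isLink_iff_inc, isLink_iff_inc, hinc, hinc, hends]

end Graph

section Deficient

variable {α β : Type*} {G : Graph α β} {U W : Set α} {F : Set β}

/-- The edges of `G` with at least one end in `W`, the neighbourhood of `W` in a Hall-type condition
between vertices and edges. -/
def touching (G : Graph α β) (W : Set α) : Set β := {e | ∃ w ∈ W, G.Inc e w}

/-- A set of vertices is deficient if it touches fewer edges than it has elements. The minimal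
deficient sets turn out to be the vertex sets of tree components. -/
def IsDeficient (G : Graph α β) (W : Set α) : Prop :=
  W ⊆ V(G) ∧ (touching G W).ncard < W.ncard

lemma touching_subset_edgeSet (G : Graph α β) (W : Set α) : touching G W ⊆ E(G) :=
  fun _ ⟨_, _, he⟩ => he.edge_mem

lemma touching_mono (G : Graph α β) (h : U ⊆ W) : touching G U ⊆ touching G W :=
  fun _ ⟨w, hw, he⟩ => ⟨w, h hw, he⟩

lemma edgeSet_subset_touching {H : Graph α β} (hle : H ≤ G) : E(H) ⊆ touching G V(H) := by
  intro e he
  obtain ⟨x, y, hxy⟩ := H.exists_isLink_of_mem_edgeSet he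
  exact ⟨x, hxy.left_mem, (hxy.mono hle).inc_left⟩

lemma ncard_lt_of_disjoint_touching (hG : G.IsFinite) (hW : Minimal (IsDeficient G) W)
    (hUW : U ⊆ W) (hU : U.Nonempty) (hFW : F ⊆ touching G W)
    (hF : Disjoint F (touching G (W \ U))) : F.ncard < U.ncard := by
  have hWf : W.Finite := hG.1.subset hW.prop.1
  have htf : ∀ Z, (touching G Z).Finite := fun Z => hG.2.subset (touching_subset_edgeSet G Z)
  have hrest : (W \ U).ncard ≤ (touching G (W \ U)).ncard := by
    by_contra! hlt
    obtain ⟨u, hu⟩ := hU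
    exact (hW.2 ⟨sdiff_subset.trans hW.prop.1, hlt⟩ sdiff_subset (hUW hu)).2 hu
  have hunion := ncard_le_ncard
    (union_subset hFW (touching_mono G (sdiff_subset : W \ U ⊆ W))) (htf W)
  rw [ncard_union_eq hF ((htf W).subset hFW) (htf _)] at hunion
  have hWcard := ncard_sdiff_add_ncard_of_subset hUW hWf
  have hdef := hW.prop.2
  omega

lemma touching_sdiff_singleton (hG : G.IsFinite) (hW : Minimal (IsDeficient G) W) {w : α}
    (hw : w ∈ W) : touching G (W \ {w}) = touching G W := by
  refine (touching_mono G sdiff_subset).antisymm (sdiff_eq_empty.1 ?_)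
  have hlt := ncard_lt_of_disjoint_touching hG hW (singleton_subset_iff.2 hw)
    (singleton_nonempty w) (F := touching G W \ touching G (W \ {w})) sdiff_subset
    disjoint_sdiff_left
  rw [ncard_singleton, Nat.lt_one_iff,
    ncard_eq_zero (hG.2.subset (sdiff_subset.trans (touching_subset_edgeSet G W)))] at hlt
  exact hlt

lemma mem_of_isLink_of_minimal (hG : G.IsFinite) (hW : Minimal (IsDeficient G) W) {e : β}
    {x y : α} (hxy : G.IsLink e x y) (hx : x ∈ W) : y ∈ W := by
  obtain ⟨w, ⟨hwW, hwx⟩, hew⟩ : e ∈ touching G (W \ {x}) :=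
    touching_sdiff_singleton hG hW hx ▸ ⟨x, hx, hxy.inc_left⟩
  rcases hew.eq_or_eq_of_isLink hxy with rfl | rfl
  · exact absurd rfl hwx
  · exact hwW

lemma induce_isClosedSubgraph_of_minimal (hG : G.IsFinite) (hW : Minimal (IsDeficient G) W) :
    G.induce W ≤c G := by
  refine IsClosedSubgraph.mk' (induce_le hW.prop.1) ?_
  rintro e x ⟨y, hxy⟩ hx
  have hlink : (G.induce W).IsLink e x y := ⟨hxy, hx, mem_of_isLink_of_minimal hG hW hxy hx⟩
  exact hlink.edge_mem

/-- The vertices reachable from `x` form a deficient set, so they are all of `W`. -/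
lemma induce_isConnected_of_minimal (hG : G.IsFinite) (hW : Minimal (IsDeficient G) W) :
    (G.induce W).IsConnected := by
  have hWne : W.Nonempty := nonempty_of_ncard_ne_zero (Nat.ne_zero_of_lt hW.prop.2)
  refine ⟨hWne, fun x hx y hy => ?_⟩
  let R : Set α := {z | z ∈ W ∧ Relation.ReflTransGen (G.induce W).Adj x z}
  have hRW : R ⊆ W := fun z hz => hz.1
  have hdisj : Disjoint (touching G R) (touching G (W \ R)) := by
    rw [disjoint_left]
    rintro e ⟨a, ha, c, hac⟩ ⟨b, hb, heb⟩
    rcases heb.eq_or_eq_of_isLink hac with rfl | rfl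
    · exact hb.2 ha
    · exact hb.2 ⟨hb.1, ha.2.tail ⟨e, hac, ha.1, hb.1⟩⟩
  have hR : IsDeficient G R := ⟨hRW.trans hW.prop.1,
    ncard_lt_of_disjoint_touching hG hW hRW ⟨x, hx, .refl⟩ (touching_mono G hRW) hdisj⟩
  exact (hW.2 hR hRW hy).2

lemma induce_isTreeGraph_of_minimal (hG : G.IsFinite) (hW : Minimal (IsDeficient G) W) :
    (G.induce W).IsTreeGraph := by
  refine ⟨induce_isConnected_of_minimal hG hW, fun H hHW hH => ?_⟩
  have hHG : H ≤ G := hHW.trans (induce_le hW.prop.1)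
  have hHV : V(H) ⊆ W := hHW.vertexSet_mono
  refine (hH.ncard_eq (isFinite_of_le hG hHG).2).not_lt
    (ncard_lt_of_disjoint_touching hG hW hHV hH.2.1.1
      ((edgeSet_subset_touching hHG).trans (touching_mono G hHV)) ?_)
  rw [disjoint_left]
  rintro e he ⟨w, hw, hew⟩
  obtain ⟨x, y, hxy⟩ := H.exists_isLink_of_mem_edgeSet he
  rcases hew.eq_or_eq_of_isLink (hxy.mono hHG) with rfl | rfl
  · exact hw.2 hxy.left_mem
  · exact hw.2 hxy.right_mem

lemma ncard_le_ncard_touching (hG : G.IsFinite)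
    (htree : ∀ T : Graph α β, T.IsComponent G → ¬ T.IsTreeGraph) (hW : W ⊆ V(G)) :
    W.ncard ≤ (touching G W).ncard := by
  by_contra! hlt
  have hfin : {Z | IsDeficient G Z}.Finite := hG.1.finite_subsets.subset fun Z hZ => hZ.1
  obtain ⟨Z, hZ⟩ := hfin.exists_minimal ⟨W, hW, hlt⟩
  exact htree _ ⟨induce_isClosedSubgraph_of_minimal hG hZ, induce_isConnected_of_minimal hG hZ⟩
    (induce_isTreeGraph_of_minimal hG hZ)

lemma touching_deleteVerts_subset (G : Graph α β) (v : α) (W : Set α) :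
    touching (G.deleteVerts {v}) W ⊆ touching G W \ G.vertexStar v := by
  rintro e ⟨w, hw, y, hwy⟩
  obtain ⟨hwy, hwv, hyv⟩ := (deleteVerts_isLink ..).1 hwy
  refine ⟨⟨w, hw, hwy.inc_left⟩, fun hev => ?_⟩
  rcases Inc.eq_or_eq_of_isLink hev hwy with rfl | rfl
  · exact hwv rfl
  · exact hyv rfl

lemma ncard_le_ncard_touching_inter_insert (hG : G.IsFinite) {v : α}
    (htree : ∀ T : Graph α β, T.IsComponent (G.deleteVerts {v}) → ¬ T.IsTreeGraph) {e : β}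
    (he : e ∈ G.vertexStar v) (hW : W ⊆ V(G)) :
    W.ncard ≤ (touching G W ∩ insert e (E(G) \ G.vertexStar v)).ncard := by
  have hdel := ncard_le_ncard_touching (isFinite_of_le hG deleteVerts_le) htree
    (W := W \ {v}) (by rw [vertexSet_deleteVerts]; exact sdiff_subset_sdiff_left hW)
  set A := touching (G.deleteVerts {v}) (W \ {v})
  have hAG : A ⊆ touching G W \ G.vertexStar v := (touching_deleteVerts_subset G v _).trans
    (sdiff_subset_sdiff_left (touching_mono G sdiff_subset))
  have hA : A ⊆ touching G W ∩ insert e (E(G) \ G.vertexStar v) := fun f hf =>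
    ⟨(hAG hf).1, Or.inr ⟨touching_subset_edgeSet G W (hAG hf).1, (hAG hf).2⟩⟩
  have hfin : (touching G W ∩ insert e (E(G) \ G.vertexStar v)).Finite :=
    hG.2.subset (inter_subset_left.trans (touching_subset_edgeSet G W))
  by_cases hvW : v ∈ W
  · have heA : e ∉ A := fun h => (hAG h).2 he
    have heX : e ∈ touching G W ∩ insert e (E(G) \ G.vertexStar v) :=
      ⟨⟨v, hvW, he⟩, mem_insert ..⟩
    have hins := ncard_le_ncard (insert_subset heX hA) hfin
    rw [ncard_insert_of_notMem heA (hfin.subset hA)] at hins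
    have hWcard := ncard_sdiff_singleton_add_one hvW (hG.1.subset hW)
    omega
  · rw [sdiff_singleton_eq_self hvW] at hdel
    exact hdel.trans (ncard_le_ncard hA hfin)

end Deficient

section Rank

variable {α β : Type*} {G : Graph α β} {hG : G.IsFinite} {k : ℕ} {hk : 1 ≤ k}
  {B I J K T X Z : Set β} {e : β}

/-- An edge set `T` is tight if `|T| - |V(G⟨T⟩)| = k - 1`, which is the largest excess a nonempty
subset of an independent set of `Mₖ(G)` can have. The equation is stated without subtraction. -/
def IsTight (G : Graph α β) (k : ℕ) (T : Set β) : Prop := T.ncard + 1 = (G.ends T).ncard + k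

instance finite_kCircularMatroid : (G.kCircularMatroid hG k hk).Finite := ⟨hG.2⟩

lemma indep_iff_ncard_lt : (G.kCircularMatroid hG k hk).Indep I ↔
    I ⊆ E(G) ∧ ∀ Y ⊆ I, Y.ncard < (G.ends Y).ncard + k := by
  have hindep : (G.kCircularMatroid hG k hk).Indep I ↔
    I ⊆ E(G) ∧ ∀ C ∈ G.circuitFamily k, ¬ C ⊆ I := Iff.rfl
  rw [hindep]
  exact and_congr_right fun hI => forall_circuitFamily_not_subset_iff G hk hI (hG.2.subset hI)

lemma ncard_lt_of_indep (hI : (G.kCircularMatroid hG k hk).Indep I) :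
    I.ncard < (G.ends I).ncard + k :=
  (indep_iff_ncard_lt.1 hI).2 I subset_rfl

lemma finite_of_indep (hI : (G.kCircularMatroid hG k hk).Indep I) : I.Finite :=
  hG.2.subset hI.subset_ground

lemma IsTight.union (hT : IsTight G k T) (hZ : IsTight G k Z)
    (hTZ : (G.kCircularMatroid hG k hk).Indep (T ∪ Z)) : IsTight G k (T ∪ Z) := by
  have hTf : T.Finite := (finite_of_indep hTZ).subset subset_union_left
  have hZf : Z.Finite := (finite_of_indep hTZ).subset subset_union_right
  have hunion := ncard_lt_of_indep hTZ
  have hinter := ncard_lt_of_indep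
    (hTZ.subset (inter_subset_left.trans subset_union_left : T ∩ Z ⊆ T ∪ Z))
  have hedges := ncard_union_add_ncard_inter T Z hTf hZf
  have hends := ncard_union_add_ncard_inter (G.ends T) (G.ends Z) (G.finite_ends hTf)
    (G.finite_ends hZf)
  have hends_inter := ncard_le_ncard (G.ends_inter_subset T Z)
    ((G.finite_ends hTf).subset inter_subset_left)
  rw [← ends_union] at hends
  rw [IsTight] at hT hZ ⊢
  omega

lemma IsTight.not_indep_insert (hT : IsTight G k T) (heT : e ∉ T)
    (he : G.ends {e} ⊆ G.ends T) : ¬ (G.kCircularMatroid hG k hk).Indep (insert e T) := by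
  intro hind
  have hlt := ncard_lt_of_indep hind
  rw [ncard_insert_of_notMem heT ((finite_of_indep hind).subset (subset_insert e T)),
    insert_eq, ends_union, union_eq_self_of_subset_left he] at hlt
  rw [IsTight] at hT
  omega

lemma exists_isTight_of_not_indep_insert (hI : (G.kCircularMatroid hG k hk).Indep I)
    (heE : e ∈ E(G)) (hdep : ¬ (G.kCircularMatroid hG k hk).Indep (insert e I)) :
    ∃ T ⊆ I, IsTight G k T ∧ G.ends {e} ⊆ G.ends T := by
  have hIE : insert e I ⊆ E(G) := insert_subset heE hI.subset_ground
  obtain ⟨Y, hYI, hY⟩ : ∃ Y ⊆ insert e I, (G.ends Y).ncard + k ≤ Y.ncard := by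
    by_contra! hlt
    exact hdep (indep_iff_ncard_lt.2 ⟨hIE, hlt⟩)
  have hYf : Y.Finite := hG.2.subset (hYI.trans hIE)
  have heY : e ∈ Y := by
    by_contra heY
    exact hY.not_gt (ncard_lt_of_indep (hI.subset ((subset_insert_iff_of_notMem heY).1 hYI)))
  have hTI : Y \ {e} ⊆ I := sdiff_singleton_subset_iff.2 hYI
  have hsub : G.ends (Y \ {e}) ⊆ G.ends Y := G.ends_mono sdiff_subset
  have hlt := ncard_lt_of_indep (hI.subset hTI)
  have hcard := ncard_sdiff_singleton_add_one heY hYf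
  have hle := ncard_le_ncard hsub (G.finite_ends hYf)
  refine ⟨Y \ {e}, hTI, by rw [IsTight]; omega, ?_⟩
  rw [eq_of_subset_of_ncard_le hsub (by omega) (G.finite_ends hYf)]
  exact G.ends_mono (singleton_subset_iff.2 heY)

lemma exists_isGreatest_isTight (hI : (G.kCircularMatroid hG k hk).Indep I)
    (hne : ∃ T ⊆ I, IsTight G k T) : ∃ T, IsGreatest {T | T ⊆ I ∧ IsTight G k T} T := by
  have hfin : {T | T ⊆ I ∧ IsTight G k T}.Finite :=
    (finite_of_indep hI).finite_subsets.subset fun T hT => hT.1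
  obtain ⟨T, hT⟩ := hfin.exists_maximal hne
  refine ⟨T, hT.prop, fun Z hZ => ?_⟩
  have hTZ : T ∪ Z ⊆ I := union_subset hT.prop.1 hZ.1
  exact subset_union_right.trans
    (hT.2 ⟨hTZ, hT.prop.2.union hZ.2 (hI.subset hTZ)⟩ subset_union_left)

lemma exists_isGreatest_isTight_of_isBasis (hI : (G.kCircularMatroid hG k hk).IsBasis I X)
    (hne : I ≠ X) : ∃ T, IsGreatest {T | T ⊆ I ∧ IsTight G k T} T ∧
      G.ends (X \ I) ⊆ G.ends T := by
  have hcover : ∀ e ∈ X \ I, ∃ T ⊆ I, IsTight G k T ∧ G.ends {e} ⊆ G.ends T := fun e he =>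
    exists_isTight_of_not_indep_insert hI.indep (hI.subset_ground he.1) (hI.insert_dep he).not_indep
  obtain ⟨e, heX, heI⟩ := exists_of_ssubset (hI.subset.ssubset_of_ne hne)
  obtain ⟨T₀, hT₀I, hT₀, -⟩ := hcover e ⟨heX, heI⟩
  obtain ⟨T, hT⟩ := exists_isGreatest_isTight hI.indep ⟨T₀, hT₀I, hT₀⟩
  refine ⟨T, hT, ?_⟩
  rintro x ⟨f, hf, hfx⟩
  obtain ⟨Z, hZI, hZ, hfZ⟩ := hcover f hf
  exact G.ends_mono (hT.2 ⟨hZI, hZ⟩) (hfZ ⟨f, rfl, hfx⟩)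

lemma ne_of_isBasis_of_not_isColoop (hI : (G.kCircularMatroid hG k hk).IsBasis I X)
    (hX : X.Nonempty) (hcol : ∀ e, ¬ ((G.kCircularMatroid hG k hk).restrict X).IsColoop e) :
    I ≠ X := by
  rintro rfl
  obtain ⟨e, heI⟩ := hX
  obtain ⟨J, hJ, heJ⟩ := exists_isBase_notMem (hcol e)
  exact heJ (hJ.eq_of_subset_isBase hI.isBase_restrict hJ.subset_ground ▸ heI)

/-- If `f ∈ I` is exchanged for `e ∈ X \ I`, the tight subset of `I` that covers `e` contains `f`.
So `I` is a union of tight sets. -/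
lemma subset_of_isGreatest_isTight (hI : (G.kCircularMatroid hG k hk).IsBasis I X)
    (hcol : ∀ e, ¬ ((G.kCircularMatroid hG k hk).restrict X).IsColoop e)
    (hT : IsGreatest {T | T ⊆ I ∧ IsTight G k T} T) : I ⊆ T := by
  intro f hfI
  obtain ⟨J, hJ, hfJ⟩ := exists_isBase_notMem (hcol f)
  obtain ⟨e, ⟨heJ, heI⟩, hexch⟩ := hI.isBase_restrict.exchange hJ ⟨hfI, hfJ⟩
  have heX : e ∈ X := hJ.subset_ground heJ
  obtain ⟨Z, hZI, hZ, heZ⟩ := exists_isTight_of_not_indep_insert hI.indep (hI.subset_ground heX)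
    (hI.insert_dep ⟨heX, heI⟩).not_indep
  refine hT.2 ⟨hZI, hZ⟩ (by_contra fun hfZ => ?_)
  exact hZ.not_indep_insert (fun h => heI (hZI h)) heZ (hexch.indep.of_restrict.subset
    (insert_subset_insert (subset_sdiff_singleton hZI hfZ)))

lemma ncard_add_one_eq_of_isBasis (hI : (G.kCircularMatroid hG k hk).IsBasis I X) (hX : X.Nonempty)
    (hcol : ∀ e, ¬ ((G.kCircularMatroid hG k hk).restrict X).IsColoop e) :
    I.ncard + 1 = (G.ends X).ncard + k := by
  obtain ⟨T, hT, hends⟩ :=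
    exists_isGreatest_isTight_of_isBasis hI (ne_of_isBasis_of_not_isColoop hI hX hcol)
  obtain rfl : T = I := hT.1.1.antisymm (subset_of_isGreatest_isTight hI hcol hT)
  have hXT : G.ends X = G.ends T := by
    rw [← union_sdiff_cancel hI.subset, ends_union, union_eq_self_of_subset_right hends]
  rw [hXT]
  exact hT.1.2

lemma ncard_add_one_eq_of_isBase (hiso : G.NoIsolatedVertex) (hE : E(G).Nonempty)
    (hcol : ∀ e, ¬ (G.kCircularMatroid hG k hk).IsColoop e)
    (hB : (G.kCircularMatroid hG k hk).IsBase B) : B.ncard + 1 = V(G).ncard + k := by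
  rw [← ends_edgeSet hiso]
  refine ncard_add_one_eq_of_isBasis hB.isBasis_ground hE ?_
  rwa [show E(G) = (G.kCircularMatroid hG k hk).E from rfl, Matroid.restrict_ground_eq_self]

end Rank

section Star

variable {α α' β : Type*} {G : Graph α β} {G' : Graph α' β} {hG : G.IsFinite} {hG' : G'.IsFinite}
  {k : ℕ} {hk : 1 ≤ k} {I K X : Set β} {x y v : α} {e : β}

lemma not_spanning_sdiff_vertexStar (hiso : G.NoIsolatedVertex)
    (hcol : ∀ e, ¬ (G.kCircularMatroid hG k hk).IsColoop e) (hx : x ∈ V(G)) :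
    ¬ (G.kCircularMatroid hG k hk).Spanning (E(G) \ G.vertexStar x) := by
  intro hspan
  obtain ⟨B, hB, hBx⟩ := hspan.exists_isBase_subset
  have hE : E(G).Nonempty := (hiso x hx).imp fun _ he => he.edge_mem
  have hrank := ncard_add_one_eq_of_isBase hiso hE hcol hB
  have hends := ncard_le_ncard
    ((G.ends_mono hBx).trans (ends_sdiff_vertexStar_subset G _ x)) (hG.1.subset sdiff_subset)
  have hlt := ncard_lt_of_indep hB.indep
  have hV := ncard_sdiff_singleton_add_one hx hG.1
  omega

lemma ncard_ends_sdiff_add_one (hiso : G.NoIsolatedVertex)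
    (hcol : ∀ e, ¬ (G.kCircularMatroid hG k hk).IsColoop e)
    (hK : (G.kCircularMatroid hG k hk).IsCocircuit K)
    (hKcol : ∀ e, ¬ ((G.kCircularMatroid hG k hk).delete K).IsColoop e) :
    (G.ends (E(G) \ K)).ncard + 1 = V(G).ncard := by
  obtain ⟨e, heK⟩ := hK.nonempty
  obtain ⟨a, b, hab⟩ := G.exists_isLink_of_mem_edgeSet (hK.subset_ground heK)
  obtain ⟨B, hB⟩ := (G.kCircularMatroid hG k hk).exists_isBase
  obtain ⟨J, hJ⟩ := ((G.kCircularMatroid hG k hk).delete K).exists_isBase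
  have hJK := Matroid.delete_isBase_iff.1 hJ
  have hrank := ncard_add_one_eq_of_isBase hiso ⟨e, hab.edge_mem⟩ hcol hB
  have hcard : J.ncard + 1 = B.ncard := by
    have hencard := encard_add_one_eq_of_isBase_delete hK hJ hB
    rw [← (finite_of_indep hJK.indep).cast_ncard_eq,
      ← (finite_of_indep hB.indep).cast_ncard_eq] at hencard
    exact_mod_cast hencard
  rcases (E(G) \ K).eq_empty_or_nonempty with hempty | hne
  · have hJ₀ : J = ∅ := subset_empty_iff.1 (hempty ▸ hJK.subset)
    have hends : G.ends (∅ : Set β) = ∅ := by simp [ends]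
    have hV : V(G).ncard ≠ 0 := ncard_ne_zero_of_mem hab.left_mem hG.1
    rw [hJ₀, ncard_empty] at hcard
    rw [hempty, hends, ncard_empty]
    omega
  · have hdel := ncard_add_one_eq_of_isBasis hJK hne hKcol
    rw [show (G.kCircularMatroid hG k hk).E = E(G) from rfl] at hdel
    omega

lemma exists_eq_vertexStar (hiso : G.NoIsolatedVertex)
    (hcol : ∀ e, ¬ (G.kCircularMatroid hG k hk).IsColoop e)
    (hK : (G.kCircularMatroid hG k hk).IsCocircuit K)
    (hKcol : ∀ e, ¬ ((G.kCircularMatroid hG k hk).delete K).IsColoop e) :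
    ∃ x ∈ V(G), K = G.vertexStar x := by
  have hcard := ncard_ends_sdiff_add_one hiso hcol hK hKcol
  obtain ⟨x, hxV, hx⟩ : ∃ x ∈ V(G), x ∉ G.ends (E(G) \ K) :=
    exists_mem_notMem_of_ncard_lt_ncard (by omega) (hG.1.subset (ends_subset_vertexSet G _))
  exact ⟨x, hxV, (Matroid.isCocircuit_iff_minimal_compl_nonspanning.1 hK).eq_of_superset
    (not_spanning_sdiff_vertexStar hiso hcol hxV) (vertexStar_subset_of_notMem_ends hx)⟩

lemma eq_of_vertexStar_eq (hiso : G.NoIsolatedVertex)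
    (hcol : ∀ e, ¬ (G.kCircularMatroid hG k hk).IsColoop e)
    (hK : (G.kCircularMatroid hG k hk).IsCocircuit (G.vertexStar x))
    (hKcol : ∀ e, ¬ ((G.kCircularMatroid hG k hk).delete (G.vertexStar x)).IsColoop e)
    (hx : x ∈ V(G)) (hy : y ∈ V(G)) (hxy : G.vertexStar x = G.vertexStar y) : x = y := by
  have hcard := ncard_ends_sdiff_add_one hiso hcol hK hKcol
  have hV := ncard_sdiff_singleton_add_one hx hG.1
  have hends : G.ends (E(G) \ G.vertexStar x) = V(G) \ {x} :=
    eq_of_subset_of_ncard_le (ends_sdiff_vertexStar_subset G _ x) (by omega)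
      (hG.1.subset sdiff_subset)
  by_contra hne
  obtain ⟨e, ⟨-, hex⟩, hey⟩ : y ∈ G.ends (E(G) \ G.vertexStar x) :=
    hends ▸ ⟨hy, fun h => hne h.symm⟩
  exact hex (hxy ▸ hey)

lemma isBase_of_ncard_vertexSet_le (hI : (G.kCircularMatroid hG k hk).Indep I)
    (hcard : V(G).ncard + k ≤ I.ncard + 1) : (G.kCircularMatroid hG k hk).IsBase I := by
  obtain ⟨B, hB⟩ := (G.kCircularMatroid hG k hk).exists_isBase
  have hlt := ncard_lt_of_indep hB.indep
  have hle := ncard_le_ncard (ends_subset_vertexSet G B) hG.1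
  exact isBase_of_ncard_le hI hB (by omega)

/-- Let `W` be the set of vertices missed by the greatest tight subset `T` of a basis `I` of `X`.
All edges of `X` that touch `W` lie in `I \ T`, so `|I \ T| ≥ |W|`, that is, `I` is as large as a
base. -/
lemma isBase_of_isBasis_of_forall_ncard_le (hI : (G.kCircularMatroid hG k hk).IsBasis I X)
    (hne : I ≠ X) (hX : ∀ W ⊆ V(G), W.ncard ≤ (touching G W ∩ X).ncard) :
    (G.kCircularMatroid hG k hk).IsBase I := by
  obtain ⟨T, ⟨⟨hTI, hT⟩, -⟩, hends⟩ := exists_isGreatest_isTight_of_isBasis hI hne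
  have hIf : I.Finite := finite_of_indep hI.indep
  have hsub : touching G (V(G) \ G.ends T) ∩ X ⊆ I \ T := by
    rintro e ⟨⟨w, ⟨-, hwT⟩, hew⟩, heX⟩
    exact ⟨by_contra fun heI => hwT (hends ⟨e, ⟨heX, heI⟩, hew⟩), fun heT => hwT ⟨e, heT, hew⟩⟩
  have hle := (hX _ sdiff_subset).trans (ncard_le_ncard hsub (hIf.subset sdiff_subset))
  have hI_card := ncard_sdiff_add_ncard_of_subset hTI hIf
  have hV_card := ncard_sdiff_add_ncard_of_subset (ends_subset_vertexSet G T) hG.1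
  rw [IsTight] at hT
  exact isBase_of_ncard_vertexSet_le hI.indep (by omega)

lemma ncard_vertexStar_le_of_not_isBigVertex (hbig : ¬ G.IsBigVertex hG k hk v)
    {B : Set β} (hB : (G.kCircularMatroid hG k hk).IsBase B) :
    (G.vertexStar v).ncard + B.ncard ≤ E(G).ncard + 1 := by
  have hBE : B ⊆ E(G) := hB.subset_ground
  have hstarE : G.vertexStar v ⊆ E(G) := fun e he => Inc.edge_mem he
  have hcompl := ncard_sdiff_add_ncard_of_subset hBE hG.2
  rw [IsBigVertex, ← hB.compl_isBase_dual.encard_eq_eRank, not_lt,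
    show (G.kCircularMatroid hG k hk).E = E(G) from rfl, ← (hG.2.subset hstarE).cast_ncard_eq,
    ← (hG.2.subset (sdiff_subset : E(G) \ B ⊆ E(G))).cast_ncard_eq] at hbig
  have hle : (G.vertexStar v).ncard ≤ (E(G) \ B).ncard + 1 := by exact_mod_cast hbig
  omega

lemma spanning_insert_sdiff_vertexStar (hbig : ¬ G.IsBigVertex hG k hk v)
    (htree : ∀ T : Graph α β, T.IsComponent (G.deleteVerts {v}) → ¬ T.IsTreeGraph)
    (he : e ∈ G.vertexStar v) :
    (G.kCircularMatroid hG k hk).Spanning (insert e (E(G) \ G.vertexStar v)) := by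
  have hXE : insert e (E(G) \ G.vertexStar v) ⊆ E(G) :=
    insert_subset (Inc.edge_mem he) sdiff_subset
  obtain ⟨I, hI⟩ := (G.kCircularMatroid hG k hk).exists_isBasis _ hXE
  rw [← hI.spanning_iff_spanning]
  refine Matroid.IsBase.spanning ?_
  by_cases hIX : I = insert e (E(G) \ G.vertexStar v)
  · obtain ⟨B, hB⟩ := (G.kCircularMatroid hG k hk).exists_isBase
    have hstar := ncard_vertexStar_le_of_not_isBigVertex hbig hB
    have hstarE : G.vertexStar v ⊆ E(G) := fun e he => Inc.edge_mem he
    have hcompl := ncard_sdiff_add_ncard_of_subset hstarE hG.2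
    have hins : I.ncard = (E(G) \ G.vertexStar v).ncard + 1 := by
      rw [hIX, ncard_insert_of_notMem (fun h => h.2 he) (hG.2.subset sdiff_subset)]
    exact isBase_of_ncard_le hI.indep hB (by omega)
  · exact isBase_of_isBasis_of_forall_ncard_le hI hIX fun W hW =>
      ncard_le_ncard_touching_inter_insert hG htree he hW

lemma isCocircuit_vertexStar (hiso : G.NoIsolatedVertex)
    (hcol : ∀ e, ¬ (G.kCircularMatroid hG k hk).IsColoop e) (hv : v ∈ V(G))
    (hbig : ¬ G.IsBigVertex hG k hk v)
    (htree : ∀ T : Graph α β, T.IsComponent (G.deleteVerts {v}) → ¬ T.IsTreeGraph) :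
    (G.kCircularMatroid hG k hk).IsCocircuit (G.vertexStar v) := by
  rw [Matroid.isCocircuit_iff_minimal_compl_nonspanning, minimal_iff_forall_sdiff_singleton
    fun X Y hY hYX hX => hY (hX.superset (sdiff_subset_sdiff_right hYX) sdiff_subset)]
  refine ⟨not_spanning_sdiff_vertexStar hiso hcol hv, fun e he => not_not.2 ?_⟩
  have heE : e ∈ E(G) := Inc.edge_mem he
  rw [sdiff_sdiff_right, inter_singleton_of_mem (show e ∈ (G.kCircularMatroid hG k hk).E from heE),
    union_singleton]
  exact spanning_insert_sdiff_vertexStar hbig htree he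

lemma ncard_vertexSet_eq (hiso : G.NoIsolatedVertex) (hiso' : G'.NoIsolatedVertex)
    (hcol : ∀ e, ¬ (G.kCircularMatroid hG k hk).IsColoop e) (hE : E(G).Nonempty)
    (hM : G'.kCircularMatroid hG' k hk = G.kCircularMatroid hG k hk) :
    V(G).ncard = V(G').ncard := by
  obtain ⟨B, hB⟩ := (G.kCircularMatroid hG k hk).exists_isBase
  have hE' : E(G') = E(G) := congrArg Matroid.E hM
  have hrank := ncard_add_one_eq_of_isBase hiso hE hcol hB
  have hrank' := ncard_add_one_eq_of_isBase hiso' (hE' ▸ hE) (hM ▸ hcol) (hM ▸ hB)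
  omega

lemma exists_equiv_vertexStar_eq (hiso : G.NoIsolatedVertex) (hiso' : G'.NoIsolatedVertex)
    (hcol : ∀ e, ¬ (G.kCircularMatroid hG k hk).IsColoop e) (hv : v ∈ V(G))
    (hstar : ∀ x ∈ V(G), x ≠ v → (G.kCircularMatroid hG k hk).IsCocircuit (G.vertexStar x) ∧
      ∀ e, ¬ ((G.kCircularMatroid hG k hk).delete (G.vertexStar x)).IsColoop e)
    (hM : G'.kCircularMatroid hG' k hk = G.kCircularMatroid hG k hk) :
    ∃ ν : V(G) ≃ V(G'), ∀ x : V(G), x.1 ≠ v → G.vertexStar x = G'.vertexStar (ν x) := by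
  have hE : E(G).Nonempty := (hiso v hv).imp fun _ he => he.edge_mem
  have hcard := ncard_vertexSet_eq hiso hiso' hcol hE hM
  have hV' : V(G').Nonempty :=
    nonempty_of_ncard_ne_zero (hcard ▸ ncard_ne_zero_of_mem hv hG.1)
  have : Nonempty α' := hV'.to_type
  have hex : ∀ x ∈ V(G) \ {v}, ∃ y ∈ V(G'), G.vertexStar x = G'.vertexStar y := fun x hx =>
    exists_eq_vertexStar hiso' (hM ▸ hcol) (hM ▸ (hstar x hx.1 hx.2).1)
      (hM ▸ (hstar x hx.1 hx.2).2)
  choose! φ hφV hφ using hex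
  have hφinj : InjOn φ (V(G) \ {v}) := fun x hx y hy hxy =>
    eq_of_vertexStar_eq hiso hcol (hstar x hx.1 hx.2).1 (hstar x hx.1 hx.2).2 hx.1 hy.1
      (by rw [hφ x hx, hφ y hy, hxy])
  obtain ⟨ν, hν⟩ := exists_equiv_eqOn hG.1 hG'.1 hcard (fun x hx => hφV x hx) hφinj
  exact ⟨ν, fun x hxv => by rw [hν x ⟨x.2, hxv⟩, hφ x ⟨x.2, hxv⟩]⟩

end Star

end KCircular

theorem mainTheorem9_general {α α' β : Type*} (G : Graph α β) (G' : Graph α' β)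
    (hG : G.IsFinite) (hG' : G'.IsFinite)
    (hiso : G.NoIsolatedVertex) (hiso' : G'.NoIsolatedVertex)
    (k : ℕ) (hk : 1 ≤ k)
    (hcol : ∀ e, ¬ (G.kCircularMatroid hG k hk).IsColoop e)
    (v : α) (hv : v ∈ G.vertexSet)
    (hstar : ∀ x ∈ G.vertexSet, x ≠ v →
      (G.kCircularMatroid hG k hk).IsCocircuit (G.vertexStar x) ∧
        ∀ e, ¬ ((G.kCircularMatroid hG k hk).delete (G.vertexStar x)).IsColoop e)
    (hloop : ∀ p x, G.IsLoopAt p x → x = v)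
    (hbig : ¬ G.IsBigVertex hG k hk v)
    (htree : ∀ T : Graph α β, T.IsComponent (G.deleteVerts {v}) → ¬ T.IsTreeGraph)
    (hM : G'.kCircularMatroid hG' k hk = G.kCircularMatroid hG k hk) :
    G.vertexStars = G'.vertexStars ∧ G.StronglyIsomorphic G' := by
  have hE : G'.edgeSet = G.edgeSet := congrArg Matroid.E hM
  obtain ⟨ν, hν⟩ := KCircular.exists_equiv_vertexStar_eq hiso hiso' hcol hv hstar hM
  have hsub : G'.vertexStar (ν ⟨v, hv⟩) ⊆ G.vertexStar v :=
    KCircular.vertexStar_subset_of_forall_ne hE.subset (v := ⟨v, hv⟩) hloop ν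
      fun x hxv => (hν x fun h => hxv (Subtype.ext h)).subset
  have hnonspan : ¬ (G.kCircularMatroid hG k hk).Spanning
      (G.edgeSet \ G'.vertexStar (ν ⟨v, hv⟩)) := by
    rw [← hE, ← hM]
    exact KCircular.not_spanning_sdiff_vertexStar hiso' (hM ▸ hcol) (ν ⟨v, hv⟩).2
  have hcocircuit := KCircular.isCocircuit_vertexStar hiso hcol hv hbig htree
  have hνv : G.vertexStar v = G'.vertexStar (ν ⟨v, hv⟩) :=
    (Matroid.isCocircuit_iff_minimal_compl_nonspanning.1 hcocircuit).eq_of_superset hnonspan hsub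
  have hall : ∀ x : G.vertexSet, G.vertexStar x = G'.vertexStar (ν x) := fun x => by
    obtain rfl | hxv := eq_or_ne x ⟨v, hv⟩
    exacts [hνv, hν x fun h => hxv (Subtype.ext h)]
  exact ⟨KCircular.vertexStars_eq_of_equiv ν hall, KCircular.stronglyIsomorphic_of_equiv ν hall⟩

theorem mainTheorem9 {α α' β : Type*} (G : Graph α β) (G' : Graph α' β)
    (hG : G.IsFinite) (hG' : G'.IsFinite)
    (hiso : G.NoIsolatedVertex) (hiso' : G'.NoIsolatedVertex)
    (k : ℕ) (hk : 1 ≤ k)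
    (hconn : (G.kCircularMatroid hG k hk).IsConnectedMatroid)
    (v : α) (hv : v ∈ G.vertexSet)
    (hstar : ∀ x ∈ G.vertexSet, x ≠ v →
      (G.kCircularMatroid hG k hk).IsNonseparatingCocircuit (G.vertexStar x))
    (hloop : ∀ p x, G.IsLoopAt p x → x = v)
    (hbig : ¬ G.IsBigVertex hG k hk v)
    (htree : ∀ T : Graph α β, T.IsComponent (G.deleteVerts {v}) → ¬ T.IsTreeGraph)
    (hM : G'.kCircularMatroid hG' k hk = G.kCircularMatroid hG k hk) :
    G.vertexStars = G'.vertexStars ∧ G.StronglyIsomorphic G' :=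
  mainTheorem9_general G G' hG hG' hiso hiso' k hk hconn.2.1 v hv
    (fun x hx hxv => ⟨(hstar x hx hxv).1, (hstar x hx hxv).2.2.1⟩) hloop hbig htree hM
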